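/- Let $n\ge 2$ be an integer, let $\Delta_n=\{x\in\mathbb{R}^n : x_1\le\cdots\le x_n\}$ and let $\Phi_n\colon\mathbb{R}^n\to\Delta_n$ be the map which lists the coordinates of a point in monotone increasing order. A quasi-regular $(n,0)$-system is a continuous map $P\colon[a,\infty)\to\Delta_n$ for which there is an unbounded strictly increasing sequence of positive real numbers $(X_i)_{i\ge1}$ such that, with $q_i=(X_i+\cdots+X_{i+n-1})/n$, one has $a=q_1$ and, for each $i\ge1$, $$P(q)=\Phi_n\big(X_i+n(q-q_i)-q,\;X_{i+1}-q,\;\dots,\;X_{i+n-1}-q\big)\qquad(q_i\le q\le q_{i+1}).$$ It has mesh at least $\delta>0$ if moreover $X_{i+1}\ge X_i+\delta$ for each $i\ge1$. A regular system is a continuous map $P\colon[a,\infty)\to\Delta_n$ given by the same formulas, with $a=q_1$, for a sequence with $X_1>0$ and $X_{i+1}=\rho X_i$ $(i\ge1)$ for some $\rho>1$. For a unit vector $u\in\mathbb{R}^n$ and $q\ge0$, let $C_u(e^q)=\{x\in\mathbb{R}^n : \|x\|\le e^q,\ |x\cdot u|\le e^{-(n-1)q}\}$, where $\|\cdot\|$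 is the Euclidean norm, and let $L_u(q)=(\log\lambda_1,\dots,\log\lambda_n)$, where $\lambda_j$ is the $j$-th successive minimum of $C_u(e^q)$, that is, the smallest real $\lambda\ge0$ such that $\lambda\, C_u(e^q)$ contains at least $j$ linearly independent points of $\mathbb{Z}^n$. Theorem. Every regular system is a quasi-regular $(n,0)$-system. If $P\colon[q_1,\infty)\to\Delta_n$ is a quasi-regular $(n,0)$-system with mesh at least $\log 4$, then there is a unit vector $u\in\mathbb{R}^n$ such that $$\|P(q)-L_u(q)\|_\infty\le 2n^2\qquad\text{for all } q\ge q_1,$$ where $\|\cdot\|_\infty$ is the maximum norm. -/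

import Mathlib

open scoped Pointwise

noncomputable section

/-- The set `Δ_n` of points of `ℝ^n` with coordinates in monotone increasing order. -/
def monotoneTuples (n : ℕ) : Set (Fin n → ℝ) := {x | Monotone x}

/-- The map `Φ_n : ℝ^n → Δ_n` listing the coordinates of a point in monotone increasing order. -/
def sortTuple {n : ℕ} (x : Fin n → ℝ) : Fin n → ℝ := x ∘ Tuple.sort x

/-- The point of Euclidean space `ℝ^n` with integer coordinates `z`. -/
def integerPoint {n : ℕ} (z : Fin n → ℤ) : EuclideanSpace ℝ (Fin n) :=
  WithLp.toLp 2 fun i => (z i : ℝ)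

/-- The `j`-th successive minimum of `C` with respect to `ℤ^n`: the smallest real `t ≥ 0` such that
`t • C` contains at least `j` linearly independent elements of `ℤ^n`. -/
def successiveMinimum {n : ℕ} (C : Set (EuclideanSpace ℝ (Fin n))) (j : ℕ) : ℝ :=
  sInf {t : ℝ | 0 ≤ t ∧ ∃ z : Fin j → Fin n → ℤ,
    LinearIndependent ℝ (fun k => integerPoint (z k)) ∧ ∀ k, integerPoint (z k) ∈ t • C}

/-- The convex body `C_u(Q) = {x : ‖x‖ ≤ Q, |x · u| ≤ Q^{-(n-1)}}`. -/
def convexBodyOf {n : ℕ} (u : EuclideanSpace ℝ (Fin n)) (Q : ℝ) :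
    Set (EuclideanSpace ℝ (Fin n)) :=
  {x | ‖x‖ ≤ Q ∧ |inner ℝ x u| ≤ Q ^ (-((n : ℤ) - 1))}

/-- `L_u(q)`, the vector of logarithms of the successive minima of `C_u(e^q)`. Its coordinate of
index `j : Fin n` (counted from `0`) is attached to the minimum number `j + 1`. -/
def logMinima {n : ℕ} (u : EuclideanSpace ℝ (Fin n)) (q : ℝ) : Fin n → ℝ :=
  fun j => Real.log (successiveMinimum (convexBodyOf u (Real.exp q)) ((j : ℕ) + 1))

/-- `q_i = (X_i + ⋯ + X_{i+n-1}) / n`. Sequences are indexed from `0`. -/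
def switchPoint (n : ℕ) (X : ℕ → ℝ) (i : ℕ) : ℝ :=
  (∑ j ∈ Finset.range n, X (i + j)) / n

/-- The point `(X_i + n (q - q_i) - q, X_{i+1} - q, …, X_{i+n-1} - q)` of `ℝ^n`. -/
def unsortedSystem (n : ℕ) (X : ℕ → ℝ) (i : ℕ) (q : ℝ) : Fin n → ℝ :=
  fun j => if (j : ℕ) = 0 then X i + n * (q - switchPoint n X i) - q else X (i + j) - q

/-- `P : [a, ∞) → Δ_n` is a continuous map which is given piecewise by the sequence `X`. Only the
values of `P` on `[a, ∞)` matter. -/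
structure IsGeneratedBy (n : ℕ) (X : ℕ → ℝ) (a : ℝ) (P : ℝ → Fin n → ℝ) : Prop where
  start : a = switchPoint n X 0
  continuousOn : ContinuousOn P (Set.Ici a)
  mapsTo : Set.MapsTo P (Set.Ici a) (monotoneTuples n)
  eq_sort : ∀ i : ℕ, ∀ q ∈ Set.Icc (switchPoint n X i) (switchPoint n X (i + 1)),
    P q = sortTuple (unsortedSystem n X i q)

/-- The sequences allowed in quasi-regular systems: positive, strictly increasing, unbounded. -/
structure IsAdmissible (X : ℕ → ℝ) : Prop where
  pos : ∀ i, 0 < X i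
  strictMono : StrictMono X
  unbounded : ¬ BddAbove (Set.range X)

/-- `P : [a, ∞) → Δ_n` is a quasi-regular `(n,0)`-system. -/
def IsQuasiRegularSystem (n : ℕ) (a : ℝ) (P : ℝ → Fin n → ℝ) : Prop :=
  ∃ X : ℕ → ℝ, IsAdmissible X ∧ IsGeneratedBy n X a P

/-- `P : [a, ∞) → Δ_n` is a quasi-regular `(n,0)`-system with mesh at least `δ` (for `δ > 0`). -/
def IsQuasiRegularSystemWithMesh (n : ℕ) (δ a : ℝ) (P : ℝ → Fin n → ℝ) : Prop :=
  ∃ X : ℕ → ℝ, IsAdmissible X ∧ IsGeneratedBy n X a P ∧ ∀ i, X i + δ ≤ X (i + 1)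

/-- `P : [a, ∞) → Δ_n` is a regular system: it is generated by a geometric progression with
positive first term and ratio `ρ > 1`. -/
def IsRegularSystem (n : ℕ) (a : ℝ) (P : ℝ → Fin n → ℝ) : Prop :=
  ∃ (X : ℕ → ℝ) (ρ : ℝ), 1 < ρ ∧ 0 < X 0 ∧ (∀ i, X (i + 1) = ρ * X i) ∧ IsGeneratedBy n X a P

end

/-! Write n = m + 1. The theorem reduces to finding integer points x_0, x_1, … and a unit vector u
such that any n consecutive points are linearly independent, ‖x_k‖ is at most 21n·e^{X_k}, and |x_k
· u| ≤ e^{-(X_{k+1}+⋯+X_{k+m})} (`exists_points_and_unit_vector`). For q between q_i and q_{i+1},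
the points x_i, …, x_{i+m} then lie in dilates of C_u(e^q) by e^{c+p_j}, where c = log(21n) and the
p_j are the unsorted coordinates of P(q), with sum 0 (`exp_bounds_of_points`). A nonzero integer
determinant is at least 1 in absolute value, while vectors in dilates by a_i have determinant at
most 2^n ∏ a_i. Dilation factors with bounded product are therefore close to the successive minima
(`successiveMinimum_bounds`).

To build the points, x_{k+n} is x_k plus an integer combination of x_{k+1}, …, x_{k+m}, which keeps
the determinant of a window equal to ±1. The coefficients are rounded so that the last m coordinates
approximate a large multiple of a basis vector of ℝ^m, the axes being used cyclically
(`nearTarget`). Hence m consecutive truncated points form a diagonally dominant matrix up to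
permutation, whose determinant is at least the product of the sizes. The vector u_k with first
coordinate 1 orthogonal to x_{k+1}, …, x_{k+m} satisfies |x_k · u_k| = 1/|that determinant|, and the
u_k converge geometrically to a multiple of u (`exists_limit_vector`). -/

/-! ### Determinants: diagonal dominance, Cramer, Hadamard. -/

-- By Gershgorin every eigenvalue lies within distance 1 of 2, so has modulus at least 1. Over ℂ the
-- determinant is the product of the eigenvalues.
open Matrix in
theorem one_le_norm_det_of_near_two {ι : Type*} [Fintype ι] [DecidableEq ι] (N : Matrix ι ι ℂ)
    (h : ∀ k, ∑ j, ‖N k j - if j = k then 2 else 0‖ ≤ 1) : 1 ≤ ‖N.det‖ := by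
  have hprod : ∀ s : Multiset ℂ, (∀ a ∈ s, 1 ≤ ‖a‖) → 1 ≤ ‖s.prod‖ := by
    intro s
    induction s using Multiset.induction with
    | empty => simp
    | cons a s ih =>
      intro hs
      rw [Multiset.prod_cons, norm_mul]
      exact one_le_mul_of_one_le_of_one_le (hs a (Multiset.mem_cons_self a s))
        (ih fun b hb => hs b (Multiset.mem_cons_of_mem hb))
  rw [det_eq_prod_roots_charpoly]
  refine hprod _ fun μ hμ => ?_
  have hev : Module.End.HasEigenvalue (toLin' N) μ := by
    rw [Module.End.hasEigenvalue_iff_isRoot_charpoly, charpoly_toLin']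
    exact Polynomial.isRoot_of_mem_roots hμ
  obtain ⟨k, hk⟩ := eigenvalue_mem_ball hev
  rw [mem_closedBall_iff_norm] at hk
  have hsum := h k
  rw [← Finset.add_sum_erase _ _ (Finset.mem_univ k)] at hsum
  have hrest : ∑ j ∈ Finset.univ.erase k, ‖N k j - if j = k then 2 else 0‖
      = ∑ j ∈ Finset.univ.erase k, ‖N k j‖ :=
    Finset.sum_congr rfl fun j hj => by simp [Finset.ne_of_mem_erase hj]
  rw [hrest, if_pos rfl] at hsum
  have htri : ‖(2 : ℂ)‖ ≤ ‖μ‖ + ‖μ - N k k‖ + ‖N k k - 2‖ := by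
    calc ‖(2 : ℂ)‖ = ‖μ - (μ - N k k) - (N k k - 2)‖ := by congr 1; ring
      _ ≤ ‖μ - (μ - N k k)‖ + ‖N k k - 2‖ := norm_sub_le _ _
      _ ≤ _ := by gcongr; exact norm_sub_le _ _
  simp only [Complex.norm_ofNat] at htri
  linarith

/-- A matrix whose rows are close to multiples of distinct basis vectors has a large
determinant. -/
theorem prod_le_abs_det_of_near {ι : Type*} [Fintype ι] [DecidableEq ι] (B : Matrix ι ι ℝ)
    (σ : Equiv.Perm ι) (z : ι → ℝ) (hz : ∀ j, 0 < z j)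
    (h : ∀ j, ∑ c, |B j c - if c = σ j then 2 * z j else 0| ≤ z j) : ∏ j, z j ≤ |B.det| := by
  -- Permuting columns by `σ` and dividing row j by `z j` moves the dominant entries to the
  -- diagonal, near 2.
  set N : Matrix ι ι ℝ := Matrix.of fun j c => B j (σ c) / z j with hN
  have hB : B.submatrix id σ = Matrix.diagonal z * N := by
    ext j c
    have := (hz j).ne'
    simp only [hN, Matrix.diagonal_mul, Matrix.of_apply, Matrix.submatrix_apply, id]
    field_simp
  have hdet : |B.det| = (∏ j, z j) * |N.det| := by
    have h1 : |(B.submatrix id σ).det| = |B.det| := by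
      rw [Matrix.det_permute', abs_mul]
      rcases Int.units_eq_one_or (Equiv.Perm.sign σ) with hs | hs <;> simp [hs]
    rw [← h1, hB, Matrix.det_mul, Matrix.det_diagonal, abs_mul,
      abs_of_pos (Finset.prod_pos fun j _ => hz j)]
  have hN1 : 1 ≤ ‖(N.map Complex.ofRealHom).det‖ := by
    refine one_le_norm_det_of_near_two _ fun k => ?_
    have hk := h k
    rw [← Equiv.sum_comp σ] at hk
    have hle : ∑ c, |N k c - if c = k then 2 else 0| ≤ 1 := by
      have : ∀ c, |N k c - if c = k then 2 else 0|
          = |B k (σ c) - if σ c = σ k then 2 * z k else 0| / z k := by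
        intro c
        rw [← abs_of_pos (hz k), ← abs_div, abs_of_pos (hz k)]
        have := (hz k).ne'
        by_cases hc : c = k
        · subst hc; simp only [hN, Matrix.of_apply, if_true]; congr 1; field_simp
        · simp [hN, hc]
      rw [Finset.sum_congr rfl fun c _ => this c, ← Finset.sum_div, div_le_one (hz k)]
      exact hk
    refine le_trans (le_of_eq (Finset.sum_congr rfl fun c _ => ?_)) hle
    rw [← Real.norm_eq_abs, ← Complex.norm_real]
    congr 1
    by_cases hc : c = k <;> simp [hc]
  have hmap : (N.map Complex.ofRealHom).det = (N.det : ℂ) := by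
    have := (Complex.ofRealHom.map_det N).symm
    simpa using this
  rw [hmap, Complex.norm_real, Real.norm_eq_abs] at hN1
  rw [hdet]
  exact le_mul_of_one_le_right (Finset.prod_nonneg fun j _ => (hz j).le) hN1

/-- If the rows `B j` are close to multiples of distinct basis vectors, then some coordinate of
`B w` controls the largest coordinate of `w`. -/
theorem exists_mul_norm_le_of_near {ι : Type*} [Fintype ι] [Nonempty ι] [DecidableEq ι]
    (B : Matrix ι ι ℝ) (σ : Equiv.Perm ι) (z : ι → ℝ) (hz : ∀ j, 0 < z j)
    (h : ∀ j, ∑ c, |B j c - if c = σ j then 2 * z j else 0| ≤ z j) (w : ι → ℝ) :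
    ∃ j, z j * ‖w‖ ≤ |∑ c, B j c * w c| := by
  obtain ⟨c, hc⟩ : ∃ c, ‖w‖ = |w c| := by
    obtain ⟨c, -, hc⟩ := Finset.exists_max_image Finset.univ (fun c => |w c|) Finset.univ_nonempty
    refine ⟨c, le_antisymm ?_ (norm_le_pi_norm w c)⟩
    exact (pi_norm_le_iff_of_nonneg (abs_nonneg _)).2 fun i => hc i (Finset.mem_univ i)
  refine ⟨σ.symm c, ?_⟩
  set j := σ.symm c with hj
  have hcj : σ j = c := by simp [hj]
  have herr : |∑ d, (B j d - if d = σ j then 2 * z j else 0) * w d| ≤ z j * ‖w‖ := by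
    refine (Finset.abs_sum_le_sum_abs _ _).trans ?_
    calc ∑ d, |(B j d - if d = σ j then 2 * z j else 0) * w d|
        ≤ ∑ d, |B j d - if d = σ j then 2 * z j else 0| * ‖w‖ := by
          refine Finset.sum_le_sum fun d _ => ?_
          rw [abs_mul]
          gcongr
          exact norm_le_pi_norm w d
      _ ≤ _ := by rw [← Finset.sum_mul]; gcongr; exact h j
  have hsplit : ∑ d, (B j d - if d = σ j then 2 * z j else 0) * w d
      = ∑ d, B j d * w d - 2 * z j * w c := by
    simp [sub_mul, Finset.sum_sub_distrib, hcj]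
  rw [hsplit] at herr
  have h2 : |2 * z j * w c| = 2 * (z j * ‖w‖) := by
    rw [abs_mul, abs_of_pos (by linarith [hz j]), hc]; ring
  have h3 := abs_sub_abs_le_abs_sub (2 * z j * w c) (∑ d, B j d * w d)
  rw [abs_sub_comm] at h3
  linarith

/-- Cramer's rule for a vector with first coordinate `1` which is orthogonal to all rows but
one. -/
theorem abs_det_eq_of_mulVec_eq {m : ℕ} (M : Matrix (Fin (m + 1)) (Fin (m + 1)) ℝ)
    (u : Fin (m + 1) → ℝ) (hu : u 0 = 1) (r : Fin (m + 1)) (d : ℝ)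
    (h : ∀ i, ∑ c, M i c * u c = if i = r then d else 0) :
    |M.det| = |d| * |(M.submatrix r.succAbove Fin.succ).det| := by
  -- Since `u 0 = 1`, replacing column 0 by M u keeps the determinant. The new column is supported
  -- at `r`, so its Laplace expansion has one term.
  have h1 := Matrix.det_updateCol_sum M 0 u
  rw [hu, one_smul] at h1
  rw [← h1, Matrix.det_succ_column _ 0, Finset.sum_eq_single r]
  · have h2 : (M.updateCol 0 fun k => ∑ i, u i • M k i) r 0 = d := by
      have := h r
      rw [if_pos rfl] at this
      rw [Matrix.updateCol_self, ← this]
      simp [mul_comm]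
    have h3 : (M.updateCol 0 fun k => ∑ i, u i • M k i).submatrix r.succAbove (Fin.succAbove 0)
        = M.submatrix r.succAbove Fin.succ := by
      ext i j
      simp
    rw [h2, h3, abs_mul, abs_mul, abs_pow]
    simp
  · intro i _ hi
    have h2 : (M.updateCol 0 fun k => ∑ i, u i • M k i) i 0 = 0 := by
      have := h i
      rw [if_neg hi] at this
      rw [Matrix.updateCol_self, ← this]
      simp [mul_comm]
    rw [h2]; ring
  · simp

/-- Hadamard's inequality. -/
theorem abs_det_le_prod_norm {n : ℕ} (M : Matrix (Fin n) (Fin n) ℝ) :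
    |M.det| ≤ ∏ i, ‖(WithLp.toLp 2 (M i) : EuclideanSpace ℝ (Fin n))‖ := by
  have : Fact (Module.finrank ℝ (EuclideanSpace ℝ (Fin n)) = n) := ⟨by simp⟩
  set b := EuclideanSpace.basisFun (Fin n) ℝ
  have h := b.toBasis.orientation.abs_volumeForm_apply_le
    fun i => (WithLp.toLp 2 (M i) : EuclideanSpace ℝ (Fin n))
  rw [Orientation.volumeForm_robust _ b rfl, Module.Basis.det_apply] at h
  have hM : b.toBasis.toMatrix (fun i => (WithLp.toLp 2 (M i) : EuclideanSpace ℝ (Fin n)))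
      = M.transpose := by
    ext i j
    simp [b, Module.Basis.toMatrix_apply]
  rwa [hM, Matrix.det_transpose] at h

/-- The determinant of vectors in dilates of a convex body `C_u(R)`. -/
theorem abs_det_le_of_mem_dilates {n : ℕ} (M : Matrix (Fin n) (Fin n) ℝ)
    (u : EuclideanSpace ℝ (Fin n)) (hu : ‖u‖ = 1) (R : ℝ) (hR : 0 < R) (a : Fin n → ℝ)
    (hnorm : ∀ i, ‖(WithLp.toLp 2 (M i) : EuclideanSpace ℝ (Fin n))‖ ≤ a i * R)
    (hinner : ∀ i, |inner ℝ (WithLp.toLp 2 (M i) : EuclideanSpace ℝ (Fin n)) u| * R ^ n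
      ≤ a i * R) :
    |M.det| ≤ 2 ^ n * ∏ i, a i := by
  set y : Fin n → EuclideanSpace ℝ (Fin n) := fun i => WithLp.toLp 2 (M i) with hy
  -- `T` stretches by R^n along `u` and fixes the orthogonal complement. Each row lands in a ball of
  -- radius 2 a_i R, and the determinant R^n of `T` cancels the powers of R in Hadamard's bound.
  set T : Matrix (Fin n) (Fin n) ℝ :=
    1 + Matrix.replicateCol Unit (fun i => u i) *
      Matrix.replicateRow Unit (fun i => (R ^ n - 1) * u i) with hT
  have huu : ∑ i, u i * u i = 1 := by
    have := EuclideanSpace.real_norm_sq_eq u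
    rw [hu] at this
    simpa [sq] using this.symm
  have hdetT : T.det = R ^ n := by
    rw [hT, Matrix.det_one_add_mul_comm, Matrix.det_unique]
    simp only [Matrix.add_apply, Matrix.one_apply_eq, Matrix.mul_apply, Matrix.replicateRow_apply,
      Matrix.replicateCol_apply]
    have : ∑ i, (R ^ n - 1) * u i * u i = (R ^ n - 1) * ∑ i, u i * u i := by
      rw [Finset.mul_sum]; exact Finset.sum_congr rfl fun _ _ => by ring
    rw [this, huu]; ring
  have hrow : ∀ i, (WithLp.toLp 2 ((M * T) i) : EuclideanSpace ℝ (Fin n))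
      = (y i - inner ℝ (y i) u • u) + (R ^ n * inner ℝ (y i) u) • u := by
    intro i
    have hin : inner ℝ (y i) u = ∑ c, M i c * u c := by
      simp [hy, PiLp.inner_apply, mul_comm]
    ext c
    have : (M * T) i c = M i c + (∑ d, M i d * u d) * ((R ^ n - 1) * u c) := by
      rw [hT, mul_add, mul_one, ← Matrix.mul_assoc]
      simp [Matrix.mul_apply]
    simp only [PiLp.add_apply, PiLp.sub_apply, PiLp.smul_apply, smul_eq_mul, this, hin]
    simp only [hy]
    ring
  have hbound : ∀ i, ‖(WithLp.toLp 2 ((M * T) i) : EuclideanSpace ℝ (Fin n))‖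
      ≤ 2 * a i * R := by
    intro i
    rw [hrow]
    have h1 : ‖y i - inner ℝ (y i) u • u‖ ≤ ‖y i‖ := by
      have hsq : ‖y i - inner ℝ (y i) u • u‖ ^ 2 ≤ ‖y i‖ ^ 2 := by
        rw [@norm_sub_sq_real, inner_smul_right, norm_smul, hu, mul_one, Real.norm_eq_abs, sq_abs]
        nlinarith [sq_nonneg (inner ℝ (y i) u)]
      exact le_of_sq_le_sq hsq (norm_nonneg _)
    have h2 : ‖(R ^ n * inner ℝ (y i) u) • u‖ = |inner ℝ (y i) u| * R ^ n := by
      rw [norm_smul, hu, mul_one, Real.norm_eq_abs, abs_mul, abs_of_pos (pow_pos hR n), mul_comm]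
    calc _ ≤ ‖y i - inner ℝ (y i) u • u‖ + ‖(R ^ n * inner ℝ (y i) u) • u‖ := norm_add_le _ _
      _ ≤ a i * R + a i * R := add_le_add (h1.trans (hnorm i)) (h2.trans_le (hinner i))
      _ = _ := by ring
  have hfin : |M.det| * R ^ n ≤ (2 ^ n * ∏ i, a i) * R ^ n := by
    calc |M.det| * R ^ n = |(M * T).det| := by
          rw [Matrix.det_mul, abs_mul, hdetT, abs_of_pos (pow_pos hR n)]
      _ ≤ _ := abs_det_le_prod_norm _
      _ ≤ ∏ i, (2 * a i * R) :=
          Finset.prod_le_prod (fun i _ => norm_nonneg _) fun i _ => hbound i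
      _ = _ := by simp [Finset.prod_mul_distrib]
  exact le_of_mul_le_mul_right hfin (pow_pos hR n)

/-! ### Recursive construction of the integer points. -/

/-- The rows of a window of integer points other than the first, without first coordinates. -/
def truncatedMatrix {m : ℕ} (w : Fin (m + 1) → Fin (m + 1) → ℤ) : Matrix (Fin m) (Fin m) ℝ :=
  fun j c => (w j.succ c.succ : ℝ)

/-- The matrix of a window of integer points. -/
def windowMatrix {m : ℕ} (w : Fin (m + 1) → Fin (m + 1) → ℤ) :
    Matrix (Fin (m + 1)) (Fin (m + 1)) ℝ :=
  fun i c => (w i c : ℝ)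

/-- The integer coordinates, rounded down, of `τ` in the basis of rows of `truncatedMatrix w`. -/
noncomputable def roundedCoeff {m : ℕ} (τ : Fin m → ℝ) (w : Fin (m + 1) → Fin (m + 1) → ℤ)
    (j : Fin m) : ℤ :=
  ⌊Matrix.vecMul τ (truncatedMatrix w)⁻¹ j⌋

/-- The first point of `w` plus a combination of the other ones which approximates `τ`. -/
noncomputable def nextPoint {m : ℕ} (τ : Fin m → ℝ) (w : Fin (m + 1) → Fin (m + 1) → ℤ) :
    Fin (m + 1) → ℤ :=
  w 0 + ∑ j : Fin m, roundedCoeff τ w j • w j.succ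

/-- The direction and size approximated by the point of index `k + 1`. -/
def targetVec (m : ℕ) [NeZero m] (Z : ℕ → ℝ) (k : ℕ) : Fin m → ℝ :=
  fun c => if c = Fin.ofNat m k then 2 * Z (k + 1) else 0

/-- The successive windows of `m + 1` integer points. -/
noncomputable def window (m : ℕ) [NeZero m] (Z : ℕ → ℝ) :
    ℕ → Fin (m + 1) → Fin (m + 1) → ℤ
  | 0 => fun i j => if i = j then 1 else 0
  | k + 1 => Fin.snoc (α := fun _ => Fin (m + 1) → ℤ) (Fin.tail (window m Z k))
      (nextPoint (targetVec m Z (k + m)) (window m Z k))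

/-- The sequence of integer points. -/
noncomputable def latticePoint (m : ℕ) [NeZero m] (Z : ℕ → ℝ) (k : ℕ) : Fin (m + 1) → ℤ :=
  window m Z k 0

section construction

variable {m : ℕ} {Z : ℕ → ℝ}

/-- Conditions on the sizes of the points. -/
structure IsSizeSequence (m : ℕ) (Z : ℕ → ℝ) : Prop where
  eq_one : ∀ k ≤ m, Z k = 1
  sum_le : ∀ k, m < k → 3 * ∑ l ∈ Finset.range k, Z l ≤ Z k

theorem IsSizeSequence.one_le (hZ : IsSizeSequence m Z) (k : ℕ) : 1 ≤ Z k := by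
  induction k using Nat.strong_induction_on with
  | _ k ih =>
    rcases le_or_gt k m with h | h
    · exact (hZ.eq_one k h).ge
    · have h0 : Z 0 ≤ ∑ l ∈ Finset.range k, Z l :=
        Finset.single_le_sum (f := Z)
          (fun l hl => zero_le_one.trans (ih l (Finset.mem_range.1 hl)))
          (Finset.mem_range.2 (by omega))
      have := hZ.sum_le k h
      have := hZ.eq_one 0 (Nat.zero_le m)
      linarith

theorem IsSizeSequence.pos (hZ : IsSizeSequence m Z) (k : ℕ) : 0 < Z k :=
  zero_lt_one.trans_le (hZ.one_le k)

theorem IsSizeSequence.three_mul_le (hZ : IsSizeSequence m Z) {l k : ℕ} (hk : m < k)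
    (hl : l < k) : 3 * Z l ≤ Z k := by
  have h0 : Z l ≤ ∑ i ∈ Finset.range k, Z i :=
    Finset.single_le_sum (f := Z) (fun i _ => (hZ.pos i).le) (Finset.mem_range.2 hl)
  have := hZ.sum_le k hk
  linarith

theorem IsSizeSequence.monotone (hZ : IsSizeSequence m Z) : Monotone Z := by
  refine monotone_nat_of_le_succ fun k => ?_
  rcases lt_or_ge m (k + 1) with h | h
  · have := hZ.three_mul_le h (Nat.lt_succ_self k)
    have := hZ.pos k
    linarith
  · rw [hZ.eq_one k (by omega), hZ.eq_one _ h]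

theorem IsSizeSequence.three_pow_mul_le (hZ : IsSizeSequence m Z) {l : ℕ} (hl : m ≤ l) (k : ℕ) :
    3 ^ k * Z l ≤ Z (l + k) := by
  induction k with
  | zero => simp
  | succ k ih =>
    have := hZ.three_mul_le (show m < l + (k + 1) by omega) (show l + k < l + (k + 1) by omega)
    rw [pow_succ]
    linarith

variable [NeZero m]

theorem window_succ_castSucc (k : ℕ) (j : Fin m) :
    window m Z (k + 1) j.castSucc = window m Z k j.succ := by
  simp [window, Fin.tail]

theorem window_succ_last (k : ℕ) :
    window m Z (k + 1) (Fin.last m) = nextPoint (targetVec m Z (k + m)) (window m Z k) := by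
  simp [window]

theorem window_apply (k : ℕ) (i : Fin (m + 1)) :
    window m Z k i = latticePoint m Z (k + i) := by
  obtain ⟨i, hi⟩ := i
  induction i generalizing k with
  | zero => rfl
  | succ i ih =>
    have h := window_succ_castSucc (Z := Z) k (⟨i, by omega⟩ : Fin m)
    simp only [Fin.castSucc_mk, Fin.succ_mk] at h
    rw [← h, ih (k + 1)]
    congr 1
    simp only
    omega

theorem ofNat_add_eq (k : ℕ) (j : Fin m) : Fin.ofNat m (k + j) = Fin.ofNat m k + j := by
  ext
  simp [Fin.val_add]

/-- The point of index `k + 1` is close to its target. -/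
def NearTarget (m : ℕ) [NeZero m] (Z : ℕ → ℝ) (k : ℕ) : Prop :=
  ∑ c : Fin m, |(latticePoint m Z (k + 1) c.succ : ℝ) - targetVec m Z k c| ≤ Z (k + 1)

theorem truncatedMatrix_apply (k : ℕ) (j c : Fin m) :
    truncatedMatrix (window m Z k) j c = latticePoint m Z (k + j + 1) c.succ := by
  simp only [truncatedMatrix, window_apply, Fin.val_succ]
  rfl

/-- The targets cycle through the axes, so m consecutive ones use each axis once; the permutation is
translation by k modulo m. -/
theorem near_rows {k : ℕ} (h : ∀ j < m, NearTarget m Z (k + j)) (j : Fin m) :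
    ∑ c, |truncatedMatrix (window m Z k) j c -
      if c = Equiv.addLeft (Fin.ofNat m k) j then 2 * Z (k + j + 1) else 0| ≤ Z (k + j + 1) := by
  have := h j j.2
  unfold NearTarget targetVec at this
  simp only [truncatedMatrix_apply, Equiv.coe_addLeft, ← ofNat_add_eq]
  exact this

theorem prod_le_abs_det_truncatedMatrix (hZ : IsSizeSequence m Z) {k : ℕ}
    (h : ∀ j < m, NearTarget m Z (k + j)) :
    ∏ j : Fin m, Z (k + j + 1) ≤ |(truncatedMatrix (window m Z k)).det| :=
  prod_le_abs_det_of_near _ _ (fun j : Fin m => Z (k + j + 1)) (fun _ => hZ.pos _) (near_rows h)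

theorem NearTarget.sum_abs_le {k : ℕ} (hZ : IsSizeSequence m Z) (h : NearTarget m Z k) :
    ∑ c : Fin m, |(latticePoint m Z (k + 1) c.succ : ℝ)| ≤ 3 * Z (k + 1) := by
  have h1 : ∑ c : Fin m, |targetVec m Z k c| = 2 * Z (k + 1) := by
    rw [Finset.sum_eq_single (Fin.ofNat m k)]
    · simp only [targetVec, if_true]
      exact abs_of_pos (by linarith [hZ.pos (k + 1)])
    · intro c _ hc
      rw [targetVec, if_neg hc, abs_zero]
    · simp
  calc _ ≤ ∑ c : Fin m, (|(latticePoint m Z (k + 1) c.succ : ℝ) - targetVec m Z k c|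
        + |targetVec m Z k c|) := by
        refine Finset.sum_le_sum fun c _ => ?_
        have := abs_sub_abs_le_abs_sub (latticePoint m Z (k + 1) c.succ : ℝ) (targetVec m Z k c)
        linarith
    _ ≤ _ := by
        rw [Finset.sum_add_distrib, h1]
        unfold NearTarget at h
        linarith

theorem latticePoint_zero (c : Fin (m + 1)) :
    latticePoint m Z 0 c = if 0 = c then 1 else 0 := rfl

theorem latticePoint_of_le {k : ℕ} (hk : k ≤ m) (c : Fin (m + 1)) :
    latticePoint m Z k c = if (⟨k, by omega⟩ : Fin (m + 1)) = c then 1 else 0 := by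
  have := window_apply (m := m) (Z := Z) 0 ⟨k, by omega⟩
  simp only [zero_add] at this
  rw [← this]
  rfl

theorem latticePoint_add (k : ℕ) : latticePoint m Z (k + m + 1)
    = nextPoint (targetVec m Z (k + m)) (window m Z k) := by
  rw [← window_succ_last, window_apply]
  congr 1
  simp only [Fin.val_last]
  omega

theorem sum_abs_le_of_near (hZ : IsSizeSequence m Z) {k : ℕ}
    (h : ∀ i < k, NearTarget m Z i) :
    ∑ c : Fin m, |(latticePoint m Z k c.succ : ℝ)| ≤ 3 * Z k := by
  cases k with
  | zero =>
    have := hZ.pos 0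
    simp [latticePoint_zero, (Fin.succ_ne_zero _).symm]
    linarith
  | succ k => exact (h k (Nat.lt_succ_self k)).sum_abs_le hZ

/-- The initial points are basis vectors e of size 1 with target 2e, so their error is exactly 1.
Later errors come from the rounding and are dominated by all earlier sizes. -/
theorem nearTarget (hZ : IsSizeSequence m Z) (k : ℕ) : NearTarget m Z k := by
  induction k using Nat.strong_induction_on with
  | _ k ih =>
    rcases lt_or_ge k m with hk | hk
    · unfold NearTarget targetVec
      rw [hZ.eq_one _ hk, Finset.sum_eq_single (Fin.ofNat m k)]
      · have : (⟨k + 1, by omega⟩ : Fin (m + 1)) = (Fin.ofNat m k).succ := by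
          ext
          simp [Nat.mod_eq_of_lt hk]
        rw [latticePoint_of_le hk, if_pos this, if_pos rfl]
        norm_num
      · intro c _ hc
        have : (⟨k + 1, by omega⟩ : Fin (m + 1)) ≠ c.succ := by
          intro h
          apply hc
          ext
          have := congrArg Fin.val h
          simp only [Fin.val_succ] at this
          simp only [Fin.val_ofNat, Nat.mod_eq_of_lt hk]
          omega
        rw [latticePoint_of_le hk, if_neg this, if_neg hc]
        simp
      · simp
    · obtain ⟨k, rfl⟩ := Nat.exists_eq_add_of_le' hk
      have hrows : ∀ j < m, NearTarget m Z (k + j) := fun j hj => ih _ (by omega)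
      set B := truncatedMatrix (window m Z k) with hB
      set τ := targetVec m Z (k + m) with hτ
      have hdet : IsUnit B.det := by
        rw [isUnit_iff_ne_zero]
        have h1 := prod_le_abs_det_truncatedMatrix hZ hrows
        have h2 : 0 < ∏ j : Fin m, Z (k + j + 1) := Finset.prod_pos fun j _ => hZ.pos _
        exact abs_pos.1 (h2.trans_le h1)
      set t := Matrix.vecMul τ B⁻¹ with ht
      have htB : ∀ c, ∑ j, t j * B j c = τ c := by
        intro c
        have : Matrix.vecMul t B = τ := by
          rw [ht, Matrix.vecMul_vecMul, Matrix.nonsing_inv_mul _ hdet, Matrix.vecMul_one]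
        exact congrFun this c
      -- The deviation is x_k plus a combination of the other points of the window with coefficients
      -- ⌊t⌋ - t, of absolute value at most 1. Its ℓ¹ norm is thus at most the sum of those of the
      -- points in the window.
      have hval : ∀ c : Fin m, (latticePoint m Z (k + m + 1) c.succ : ℝ) - τ c
          = (latticePoint m Z k c.succ : ℝ) + ∑ j : Fin m, ((⌊t j⌋ : ℝ) - t j) * B j c := by
        intro c
        rw [latticePoint_add, ← htB c]
        simp only [nextPoint, Pi.add_apply, Finset.sum_apply, Pi.smul_apply, smul_eq_mul,
          roundedCoeff, sub_mul, Finset.sum_sub_distrib, Int.cast_add, Int.cast_sum,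
          Int.cast_mul]
        rw [add_sub_assoc]
        rfl
      unfold NearTarget
      calc _ ≤ ∑ c : Fin m, (|(latticePoint m Z k c.succ : ℝ)|
            + ∑ j : Fin m, |(latticePoint m Z (k + j + 1) c.succ : ℝ)|) := by
            refine Finset.sum_le_sum fun c _ => ?_
            rw [hval]
            refine (abs_add_le _ _).trans ?_
            gcongr
            refine (Finset.abs_sum_le_sum_abs _ _).trans (Finset.sum_le_sum fun j _ => ?_)
            rw [abs_mul, hB, truncatedMatrix_apply]
            refine mul_le_of_le_one_left (abs_nonneg _) ?_
            rw [abs_le]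
            constructor <;> linarith [Int.floor_le (t j), Int.lt_floor_add_one (t j)]
        _ = ∑ c : Fin m, |(latticePoint m Z k c.succ : ℝ)|
            + ∑ j : Fin m, ∑ c : Fin m, |(latticePoint m Z (k + j + 1) c.succ : ℝ)| := by
            rw [Finset.sum_add_distrib, Finset.sum_comm]
        _ ≤ 3 * Z k + ∑ j : Fin m, 3 * Z (k + j + 1) := by
            gcongr with j
            · exact sum_abs_le_of_near hZ fun i hi => ih i (by omega)
            · exact (hrows j j.2).sum_abs_le hZ
        _ = 3 * ∑ i ∈ Finset.range (m + 1), Z (k + i) := by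
            rw [Finset.sum_range_succ', ← Fin.sum_univ_eq_sum_range (fun i => Z (k + (i + 1))),
              mul_add, Finset.mul_sum, add_comm]
            rfl
        _ ≤ 3 * ∑ i ∈ Finset.range (k + m + 1), Z i := by
            rw [add_assoc k m 1, Finset.sum_range_add Z k (m + 1)]
            have : 0 ≤ ∑ i ∈ Finset.range k, Z i := Finset.sum_nonneg fun i _ => (hZ.pos i).le
            linarith
        _ ≤ _ := hZ.sum_le _ (by omega)

end construction

/-! ### Normal vectors and their limit. -/

section limit

variable {m : ℕ} {Z : ℕ → ℝ}

/-- The expected size of the product of the point of index `k` with the limit vector. -/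
noncomputable def expectedPairing (m : ℕ) (Z : ℕ → ℝ) (k : ℕ) : ℝ :=
  (∏ j : Fin m, Z (k + j + 1))⁻¹

theorem expectedPairing_nonneg (hZ : IsSizeSequence m Z) (k : ℕ) :
    0 ≤ expectedPairing m Z k :=
  inv_nonneg.2 (Finset.prod_nonneg fun _ _ => (hZ.pos _).le)

theorem expectedPairing_antitone (hZ : IsSizeSequence m Z) :
    Antitone (expectedPairing m Z) := by
  intro k l hkl
  refine inv_anti₀ (Finset.prod_pos fun _ _ => hZ.pos _) ?_
  exact Finset.prod_le_prod (fun _ _ => (hZ.pos _).le) fun j _ => hZ.monotone (by omega)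

variable [NeZero m]

/-- The pairing of the point of index `k` with a vector. -/
noncomputable def pairing (m : ℕ) [NeZero m] (Z : ℕ → ℝ) (k : ℕ) (u : Fin (m + 1) → ℝ) : ℝ :=
  ∑ c, (latticePoint m Z k c : ℝ) * u c

theorem windowMatrix_apply (k : ℕ) (i c : Fin (m + 1)) :
    windowMatrix (window m Z k) i c = latticePoint m Z (k + i) c := by
  simp only [windowMatrix, window_apply]

theorem pairing_eq_add_sum (k : ℕ) {u : Fin (m + 1) → ℝ} (hu : u 0 = 1) :
    pairing m Z k u
      = latticePoint m Z k 0 + ∑ c : Fin m, (latticePoint m Z k c.succ : ℝ) * u c.succ := by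
  rw [pairing, Fin.sum_univ_succ, hu, mul_one]

theorem isUnit_det_truncatedMatrix (hZ : IsSizeSequence m Z) (k : ℕ) :
    IsUnit (truncatedMatrix (window m Z k)).det := by
  rw [isUnit_iff_ne_zero]
  have h1 := prod_le_abs_det_truncatedMatrix hZ (k := k) fun j _ => nearTarget hZ _
  have h2 : 0 < ∏ j : Fin m, Z (k + j + 1) := Finset.prod_pos fun j _ => hZ.pos _
  exact abs_pos.1 (h2.trans_le h1)

theorem exists_normal (hZ : IsSizeSequence m Z) (k : ℕ) :
    ∃ u : Fin (m + 1) → ℝ, u 0 = 1 ∧ ∀ j < m, pairing m Z (k + j + 1) u = 0 := by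
  set B := truncatedMatrix (window m Z k) with hB
  set y : Fin m → ℝ := fun j => latticePoint m Z (k + j + 1) 0
  set v := Matrix.mulVec B⁻¹ (-y) with hv
  refine ⟨Fin.cons 1 v, rfl, fun j hj => ?_⟩
  have h : Matrix.mulVec B v = -y := by
    rw [hv, Matrix.mulVec_mulVec, Matrix.mul_nonsing_inv _ (isUnit_det_truncatedMatrix hZ k),
      Matrix.one_mulVec]
  have hj' := congrFun h ⟨j, hj⟩
  simp only [Matrix.mulVec, dotProduct, hB, truncatedMatrix_apply, Pi.neg_apply, y] at hj'
  rw [pairing_eq_add_sum _ (by rfl)]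
  simp only [Fin.cons_succ]
  rw [hj', add_neg_cancel]

/-- The vector with first coordinate `1` orthogonal to the points of index `k+1, …, k+m`. -/
noncomputable def normalVec (hZ : IsSizeSequence m Z) (k : ℕ) : Fin (m + 1) → ℝ :=
  (exists_normal hZ k).choose

theorem normalVec_zero (hZ : IsSizeSequence m Z) (k : ℕ) : normalVec hZ k 0 = 1 :=
  (exists_normal hZ k).choose_spec.1

theorem pairing_normalVec (hZ : IsSizeSequence m Z) (k : ℕ) {j : ℕ} (hj : j < m) :
    pairing m Z (k + j + 1) (normalVec hZ k) = 0 :=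
  (exists_normal hZ k).choose_spec.2 j hj

/-- The difference x_{k+m+1} - x_k is a combination of points orthogonal to `u`. -/
theorem pairing_add (k : ℕ) (u : Fin (m + 1) → ℝ) (hu : ∀ j < m, pairing m Z (k + j + 1) u = 0) :
    pairing m Z (k + m + 1) u = pairing m Z k u := by
  have h : ∀ c, (latticePoint m Z (k + m + 1) c : ℝ) = latticePoint m Z k c
      + ∑ j : Fin m, (roundedCoeff (targetVec m Z (k + m)) (window m Z k) j : ℝ)
        * latticePoint m Z (k + j + 1) c := by
    intro c
    rw [latticePoint_add]
    simp only [nextPoint, Pi.add_apply, Finset.sum_apply, Pi.smul_apply, smul_eq_mul,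
      Int.cast_add, Int.cast_sum, Int.cast_mul]
    simp only [window_apply, Fin.val_succ, Fin.val_zero, add_zero, add_assoc]
  unfold pairing at hu ⊢
  simp only [h, add_mul, Finset.sum_add_distrib, Finset.sum_mul]
  rw [Finset.sum_comm]
  simp only [mul_assoc, ← Finset.mul_sum]
  exact add_eq_left.2 (Finset.sum_eq_zero fun j _ => by rw [hu j j.2, mul_zero])

theorem abs_det_windowMatrix_eq (hZ : IsSizeSequence m Z) (k : ℕ) :
    |(windowMatrix (window m Z k)).det|
      = |pairing m Z k (normalVec hZ k)| * |(truncatedMatrix (window m Z k)).det| := by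
  rw [abs_det_eq_of_mulVec_eq _ (normalVec hZ k) (normalVec_zero hZ k) 0
    (pairing m Z k (normalVec hZ k))]
  · rfl
  · intro i
    simp only [windowMatrix_apply]
    refine Fin.cases ?_ (fun i => ?_) i
    · simp [pairing]
    · rw [if_neg (Fin.succ_ne_zero i)]
      exact pairing_normalVec hZ k i.2

/-- Consecutive windows share m points, hence the same minor and, by `pairing_add`, the same pairing
with their normal vector in Cramer's rule. Unimodularity turns the lower bound on the minor into an
upper bound on that pairing. -/
theorem abs_det_windowMatrix (hZ : IsSizeSequence m Z) (k : ℕ) :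
    |(windowMatrix (window m Z k)).det| = 1 := by
  induction k with
  | zero =>
    have : windowMatrix (window m Z 0) = 1 := by
      ext i j
      simp [windowMatrix, window, Matrix.one_apply]
    simp [this]
  | succ k ih =>
    rw [← ih, abs_det_windowMatrix_eq hZ k,
      abs_det_eq_of_mulVec_eq _ (normalVec hZ k) (normalVec_zero hZ k) (Fin.last m)
      (pairing m Z k (normalVec hZ k))]
    · congr 3
      ext i j
      simp [windowMatrix, truncatedMatrix, window_succ_castSucc]
    · intro i
      simp only [windowMatrix_apply]
      refine Fin.lastCases ?_ (fun i => ?_) i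
      · rw [if_pos rfl, ← pairing_add k _ fun j hj => pairing_normalVec hZ k hj,
          Fin.val_last, add_right_comm]
        rfl
      · rw [if_neg (Fin.castSucc_lt_last i).ne, Fin.val_castSucc, add_right_comm]
        exact pairing_normalVec hZ k i.2

theorem abs_pairing_normalVec_le (hZ : IsSizeSequence m Z) (k : ℕ) :
    |pairing m Z k (normalVec hZ k)| ≤ expectedPairing m Z k := by
  have h1 := abs_det_windowMatrix_eq hZ k
  rw [abs_det_windowMatrix hZ] at h1
  have h2 := prod_le_abs_det_truncatedMatrix hZ (k := k) fun j _ => nearTarget hZ _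
  have h3 : 0 < ∏ j : Fin m, Z (k + j + 1) := Finset.prod_pos fun j _ => hZ.pos _
  rw [expectedPairing, le_inv_comm₀ ?_ h3]
  · rw [eq_inv_of_mul_eq_one_left h1.symm, inv_inv]
    exact h2
  · by_contra h
    have : |pairing m Z k (normalVec hZ k)| = 0 := le_antisymm (not_lt.1 h) (abs_nonneg _)
    rw [this, zero_mul] at h1
    exact one_ne_zero h1

/-- Among x_{k+2}, …, x_{k+m+1}, only the last can pair nontrivially with u_k, and it does so as x_k
does. Diagonal dominance converts this into a bound on u_{k+1} - u_k. -/
theorem dist_normalVec_le (hZ : IsSizeSequence m Z) (k : ℕ) :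
    dist (normalVec hZ k) (normalVec hZ (k + 1))
      ≤ expectedPairing m Z k / Z (k + m + 1) := by
  set w : Fin m → ℝ := fun c => normalVec hZ (k + 1) c.succ - normalVec hZ k c.succ with hw
  set d := pairing m Z k (normalVec hZ k) with hd
  have hdist : dist (normalVec hZ k) (normalVec hZ (k + 1)) ≤ ‖w‖ := by
    rw [dist_pi_le_iff (norm_nonneg _)]
    intro c
    refine Fin.cases ?_ (fun c => ?_) c
    · simp [normalVec_zero]
    · rw [dist_comm, dist_eq_norm]
      exact norm_le_pi_norm w c
  refine hdist.trans ?_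
  obtain ⟨j, hj⟩ := exists_mul_norm_le_of_near _ _ (fun j : Fin m => Z (k + 1 + j + 1))
    (fun _ => hZ.pos _) (near_rows (k := k + 1) fun j _ => nearTarget hZ _) w
  have hsum : ∑ c, truncatedMatrix (window m Z (k + 1)) j c * w c
      = -pairing m Z (k + (j + 1) + 1) (normalVec hZ k) := by
    have h1 := pairing_normalVec hZ (k + 1) j.2
    rw [pairing_eq_add_sum _ (normalVec_zero hZ _)] at h1
    rw [pairing_eq_add_sum _ (normalVec_zero hZ _)]
    rw [show k + 1 + (j : ℕ) + 1 = k + (j + 1) + 1 by omega] at h1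
    simp only [truncatedMatrix_apply, hw, mul_sub, Finset.sum_sub_distrib]
    rw [show k + 1 + (j : ℕ) + 1 = k + (j + 1) + 1 by omega]
    linarith
  rw [hsum, abs_neg] at hj
  rcases Nat.lt_or_ge (j + 1) m with hjm | hjm
  · rw [pairing_normalVec hZ k hjm, abs_zero] at hj
    have : ‖w‖ ≤ 0 := nonpos_of_mul_nonpos_right hj (hZ.pos _)
    exact this.trans (div_nonneg (expectedPairing_nonneg hZ k) (hZ.pos _).le)
  · have hjm' : (j : ℕ) + 1 = m := le_antisymm j.2 hjm
    rw [show k + 1 + (j : ℕ) + 1 = k + (j + 1) + 1 by omega, hjm',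
      pairing_add k _ fun j hj => pairing_normalVec hZ k hj] at hj
    rw [le_div_iff₀ (hZ.pos _), mul_comm]
    exact hj.trans (abs_pairing_normalVec_le hZ k)

theorem dist_normalVec_add_le (hZ : IsSizeSequence m Z) (i k : ℕ) :
    dist (normalVec hZ (i + k)) (normalVec hZ (i + (k + 1)))
      ≤ expectedPairing m Z i / Z (i + m + 1) * (1 / 3) ^ k := by
  refine (dist_normalVec_le hZ (i + k)).trans ?_
  have h1 := hZ.three_pow_mul_le (show m ≤ i + m + 1 by omega) k
  rw [show i + m + 1 + k = i + k + m + 1 by omega] at h1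
  have h2 := hZ.pos (i + m + 1)
  calc _ ≤ expectedPairing m Z i / (3 ^ k * Z (i + m + 1)) := by
        gcongr
        · exact expectedPairing_nonneg hZ i
        · exact expectedPairing_antitone hZ (Nat.le_add_right i k)
    _ = _ := by
        rw [one_div, inv_pow]
        field_simp

/-- The limit of the normal vectors. -/
theorem exists_limit_vector (hZ : IsSizeSequence m Z) :
    ∃ u : Fin (m + 1) → ℝ, u 0 = 1 ∧ (∀ c, |u c| ≤ 1) ∧
      ∀ k, |pairing m Z k u| ≤ 5 / 2 * expectedPairing m Z k := by
  have hcauchy : CauchySeq (normalVec hZ) := by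
    refine cauchySeq_of_le_geometric (1 / 3)
      (expectedPairing m Z 0 / Z (0 + m + 1)) (by norm_num) fun k => ?_
    have := dist_normalVec_add_le hZ 0 k
    simpa only [zero_add] using this
  obtain ⟨u, hu⟩ := cauchySeq_tendsto_of_complete hcauchy
  -- Here 3/2 = 1/(1 - 1/3) sums the geometric series.
  have hdist : ∀ i, dist (normalVec hZ i) u
      ≤ 3 / 2 * (expectedPairing m Z i / Z (i + m + 1)) := by
    intro i
    have h1 : Filter.Tendsto (fun k => normalVec hZ (i + k)) Filter.atTop (nhds u) := by
      have := (Filter.tendsto_add_atTop_iff_nat i).2 hu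
      simpa only [add_comm] using this
    have := dist_le_of_le_geometric_of_tendsto₀ (1 / 3) _ (by norm_num)
      (dist_normalVec_add_le hZ i) h1
    rw [add_zero] at this
    refine this.trans (le_of_eq ?_)
    ring
  have hu0 : u 0 = 1 := by
    have h1 : Filter.Tendsto (fun k => normalVec hZ k 0) Filter.atTop (nhds (u 0)) :=
      (tendsto_pi_nhds.1 hu) 0
    simp only [normalVec_zero] at h1
    exact (tendsto_nhds_unique h1 tendsto_const_nhds)
  have hle1 : expectedPairing m Z 0 ≤ 1 :=
    inv_le_one_of_one_le₀ (Finset.one_le_prod fun j _ => hZ.one_le _)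
  -- The first normal vector is the basis vector of index 0, and the limit is within 1/2 of it; this
  -- bounds the coordinates of `u`.
  have hstart : ∀ c : Fin m, normalVec hZ 0 c.succ = 0 := by
    intro c
    have := pairing_normalVec hZ 0 c.2
    have hval : (⟨0 + (c : ℕ) + 1, by omega⟩ : Fin (m + 1)) = c.succ := by ext; simp
    unfold pairing at this
    simp only [latticePoint_of_le (m := m) (Z := Z) (show 0 + (c : ℕ) + 1 ≤ m by omega),
      hval] at this
    simpa using this
  refine ⟨u, hu0, fun c => ?_, fun k => ?_⟩
  · refine Fin.cases ?_ (fun c => ?_) c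
    · simp [hu0]
    · have h1 := (dist_le_pi_dist _ _ c.succ).trans (hdist 0)
      rw [hstart, dist_comm, dist_zero_right, Real.norm_eq_abs] at h1
      have h3 : 3 ≤ Z (0 + m + 1) := by
        have := hZ.three_mul_le (show m < 0 + m + 1 by omega) (show 0 < 0 + m + 1 by omega)
        linarith [hZ.one_le 0]
      have h4 : expectedPairing m Z 0 / Z (0 + m + 1) ≤ 1 / 3 :=
        div_le_div₀ zero_le_one hle1 (by norm_num) h3
      linarith
  -- The constant is 5/2 = 1 + 3/2: the pairing with u_k itself, then the cost of passing to the
  -- limit.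
  · have hsplit : pairing m Z k u = pairing m Z k (normalVec hZ k)
        + ∑ c : Fin m, (latticePoint m Z k c.succ : ℝ) * (u c.succ - normalVec hZ k c.succ) := by
      rw [pairing_eq_add_sum _ hu0, pairing_eq_add_sum _ (normalVec_zero hZ k)]
      simp only [mul_sub, Finset.sum_sub_distrib]
      ring
    have hsum : |∑ c : Fin m, (latticePoint m Z k c.succ : ℝ)
        * (u c.succ - normalVec hZ k c.succ)| ≤ 3 * Z k * dist (normalVec hZ k) u := by
      refine (Finset.abs_sum_le_sum_abs _ _).trans ?_
      calc _ ≤ ∑ c : Fin m, |(latticePoint m Z k c.succ : ℝ)| * dist (normalVec hZ k) u := by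
            refine Finset.sum_le_sum fun c _ => ?_
            rw [abs_mul]
            gcongr
            rw [← Real.norm_eq_abs, ← dist_eq_norm, dist_comm]
            exact dist_le_pi_dist _ _ c.succ
        _ ≤ _ := by
            rw [← Finset.sum_mul]
            gcongr
            exact sum_abs_le_of_near hZ fun i _ => nearTarget hZ i
    have h3 : 3 * Z k ≤ Z (k + m + 1) :=
      hZ.three_mul_le (by omega) (by omega)
    have h4 : 3 * Z k * dist (normalVec hZ k) u ≤ 3 / 2 * expectedPairing m Z k := by
      calc _ ≤ Z (k + m + 1) * (3 / 2 * (expectedPairing m Z k / Z (k + m + 1))) := by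
            gcongr
            · exact (hZ.pos _).le
            · exact hdist k
        _ = _ := by
            have := (hZ.pos (k + m + 1)).ne'
            field_simp
    rw [hsplit]
    refine (abs_add_le _ _).trans ?_
    linarith [abs_pairing_normalVec_le hZ k]

end limit

/-! ### Points of prescribed sizes. -/

theorem norm_toLp_le_sum_abs {n : ℕ} (x : Fin n → ℝ) :
    ‖(WithLp.toLp 2 x : EuclideanSpace ℝ (Fin n))‖ ≤ ∑ c, |x c| := by
  refine le_of_sq_le_sq ?_ (Finset.sum_nonneg fun _ _ => abs_nonneg _)
  rw [EuclideanSpace.real_norm_sq_eq, sq, Finset.sum_mul]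
  refine Finset.sum_le_sum fun c _ => ?_
  rw [← sq_abs, sq]
  exact mul_le_mul_of_nonneg_left
    (Finset.single_le_sum (f := fun c => |x c|) (fun _ _ => abs_nonneg _) (Finset.mem_univ c))
    (abs_nonneg _)

/-- Sizes adapted to a sequence `A` which grows at least as fast as the powers of `4`. -/
noncomputable def scaledSize (m : ℕ) (A : ℕ → ℝ) (k : ℕ) : ℝ :=
  if k ≤ m then 1 else 3 * (m + 1) * A (k - (m + 1))

theorem scaledSize_add (m : ℕ) (A : ℕ → ℝ) (k : ℕ) :
    scaledSize m A (k + m + 1) = 3 * (m + 1) * A k := by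
  rw [scaledSize, if_neg (by omega), show k + m + 1 - (m + 1) = k by omega]

/-- This is where mesh log 4 is needed: if three times the sum of the earlier sizes is at most Z_k,
including Z_k raises the bound to 4 Z_k. The factor 3(m + 1) pays for the m + 1 initial sizes equal
to 1. -/
theorem isSizeSequence_scaledSize (m : ℕ) {A : ℕ → ℝ} (hA1 : ∀ k, 1 ≤ A k)
    (hA : ∀ k, 4 * A k ≤ A (k + 1)) : IsSizeSequence m (scaledSize m A) := by
  refine ⟨fun k hk => if_pos hk, fun k hk => ?_⟩
  obtain ⟨k, rfl⟩ := Nat.exists_eq_add_of_lt hk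
  rw [add_comm m k]
  have hm : (0 : ℝ) < 3 * (m + 1) := by positivity
  induction k with
  | zero =>
    rw [scaledSize_add]
    have : ∑ l ∈ Finset.range (0 + m + 1), scaledSize m A l = m + 1 := by
      have hl : ∀ l ∈ Finset.range (0 + m + 1), scaledSize m A l = 1 := fun l hl =>
        if_pos (by have := Finset.mem_range.1 hl; omega)
      rw [Finset.sum_congr rfl hl]
      simp
    rw [this]
    exact le_mul_of_one_le_right hm.le (hA1 0)
  | succ k ih =>
    have h1 := ih (by omega)
    rw [show k + 1 + m + 1 = (k + m + 1) + 1 by omega, Finset.sum_range_succ,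
      show (k + m + 1) + 1 = k + 1 + m + 1 by omega]
    rw [scaledSize_add] at h1 ⊢
    rw [scaledSize_add]
    have h2 := mul_le_mul_of_nonneg_left (hA k) hm.le
    linarith

/-- Integer points of prescribed sizes, any `m + 1` consecutive ones being linearly independent,
together with a unit vector with which their products are as small as the sizes permit. -/
theorem exists_points_and_unit_vector {m : ℕ} (hm : 1 ≤ m) {A : ℕ → ℝ} (hA1 : ∀ k, 1 ≤ A k)
    (hA : ∀ k, 4 * A k ≤ A (k + 1)) :
    ∃ (x : ℕ → Fin (m + 1) → ℤ) (u : EuclideanSpace ℝ (Fin (m + 1))), ‖u‖ = 1 ∧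
      (∀ k, (Matrix.of fun i c : Fin (m + 1) => (x (k + i) c : ℝ)).det ≠ 0) ∧
      (∀ k, ‖integerPoint (x k)‖ ≤ 21 * (m + 1) * A k) ∧
      ∀ k, |inner ℝ (integerPoint (x k)) u| * ∏ j : Fin m, A (k + j + 1) ≤ 1 := by
  have : NeZero m := ⟨by omega⟩
  have hZ := isSizeSequence_scaledSize m hA1 hA
  set Z := scaledSize m A with hZdef
  obtain ⟨v, hv0, hv1, hv⟩ := exists_limit_vector hZ
  set V : EuclideanSpace ℝ (Fin (m + 1)) := WithLp.toLp 2 v with hV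
  have hVnorm : 1 ≤ ‖V‖ := by
    have := PiLp.norm_apply_le V 0
    simpa [hV, hv0] using this
  have hVpos : 0 < ‖V‖ := one_pos.trans_le hVnorm
  have hinner : ∀ k, inner ℝ (integerPoint (latticePoint m Z k)) V = pairing m Z k v := by
    intro k
    simp [integerPoint, hV, PiLp.inner_apply, pairing, mul_comm]
  have hApos : ∀ k, 0 < A k := fun k => one_pos.trans_le (hA1 k)
  have hm1 : (2 : ℝ) ≤ m + 1 := by
    have : (1 : ℝ) ≤ m := by exact_mod_cast hm
    linarith
  -- The shift discards the m + 1 initial basis vectors.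
  refine ⟨fun k => latticePoint m Z (k + m + 1), ‖V‖⁻¹ • V, ?_, fun k => ?_, fun k => ?_,
    fun k => ?_⟩
  · rw [norm_smul, norm_inv, norm_norm, inv_mul_cancel₀ hVpos.ne']
  · have h1 := abs_det_windowMatrix hZ (k + m + 1)
    have h2 : windowMatrix (window m Z (k + m + 1))
        = Matrix.of fun i c : Fin (m + 1) => (latticePoint m Z (k + i + m + 1) c : ℝ) := by
      ext i c
      rw [windowMatrix_apply, Matrix.of_apply, show k + m + 1 + (i : ℕ) = k + i + m + 1 by omega]
    rw [h2] at h1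
    intro h
    rw [h, abs_zero] at h1
    exact zero_ne_one h1
  · have hsum := sum_abs_le_of_near hZ (k := k + m + 1) fun i _ => nearTarget hZ i
    have hZk : Z (k + m + 1) = 3 * (m + 1) * A k := scaledSize_add m A k
    have hE : expectedPairing m Z (k + m + 1) ≤ 1 :=
      inv_le_one_of_one_le₀ (Finset.one_le_prod fun j _ => hZ.one_le _)
    have hZ3 : 6 ≤ Z (k + m + 1) := by
      rw [hZk]
      nlinarith [hA1 k]
    have h0 : |(latticePoint m Z (k + m + 1) 0 : ℝ)| ≤ 5 / 2 + 3 * Z (k + m + 1) := by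
      have h1 := pairing_eq_add_sum (Z := Z) (k + m + 1) hv0
      have h2 : |∑ c : Fin m, (latticePoint m Z (k + m + 1) c.succ : ℝ) * v c.succ|
          ≤ 3 * Z (k + m + 1) := by
        refine (Finset.abs_sum_le_sum_abs _ _).trans (le_trans ?_ hsum)
        refine Finset.sum_le_sum fun c _ => ?_
        rw [abs_mul]
        exact mul_le_of_le_one_right (abs_nonneg _) (hv1 _)
      have h3 := hv (k + m + 1)
      rw [eq_sub_of_add_eq h1.symm]
      refine (abs_sub _ _).trans ?_
      linarith
    calc ‖integerPoint (latticePoint m Z (k + m + 1))‖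
        ≤ ∑ c, |(latticePoint m Z (k + m + 1) c : ℝ)| := norm_toLp_le_sum_abs _
      -- The tail contributes 3Z and the first coordinate 3Z + 5/2 ≤ 4Z; then 21 = 7 · 3.
      _ ≤ 7 * Z (k + m + 1) := by
          rw [Fin.sum_univ_succ]
          linarith
      _ = _ := by rw [hZk]; ring
  · have hprod : 0 < ∏ j : Fin m, A (k + j + 1) := Finset.prod_pos fun j _ => hApos _
    have hE : expectedPairing m Z (k + m + 1)
        = ((3 * (m + 1)) ^ m * ∏ j : Fin m, A (k + j + 1))⁻¹ := by
      rw [expectedPairing]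
      congr 1
      have : ∀ j : Fin m, Z (k + m + 1 + j + 1) = 3 * (m + 1) * A (k + j + 1) := by
        intro j
        rw [← scaledSize_add m A (k + j + 1), hZdef]
        congr 1
        omega
      simp only [this, Finset.prod_mul_distrib, Finset.prod_const, Finset.card_univ,
        Fintype.card_fin, mul_pow]
    -- The scaling of the sizes gains this factor in the pairing, which absorbs 5/2.
    have h6 : (6 : ℝ) ≤ (3 * (m + 1)) ^ m :=
      le_trans (by linarith) (le_self_pow₀ (by linarith : (1 : ℝ) ≤ 3 * (m + 1)) (by omega))
    have h1 : |inner ℝ (integerPoint (latticePoint m Z (k + m + 1))) (‖V‖⁻¹ • V)|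
        ≤ 5 / 2 * expectedPairing m Z (k + m + 1) := by
      rw [inner_smul_right, abs_mul, hinner, abs_of_pos (inv_pos.2 hVpos)]
      exact (mul_le_of_le_one_left (abs_nonneg _) (inv_le_one_of_one_le₀ hVnorm)).trans (hv _)
    calc _ ≤ 5 / 2 * expectedPairing m Z (k + m + 1) * ∏ j : Fin m, A (k + j + 1) := by gcongr
      _ = 5 / 2 / (3 * (m + 1)) ^ m := by
          rw [hE]
          have := hprod.ne'
          field_simp
      _ ≤ 1 := by
          rw [div_le_one (by linarith)]
          linarith

/-! ### Successive minima of C_u(Q). -/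

theorem zpow_neg_mul_pow {Q : ℝ} (hQ : 0 < Q) (n : ℕ) :
    Q ^ (-((n : ℤ) - 1)) * Q ^ n = Q := by
  rw [← zpow_natCast, ← zpow_add₀ hQ.ne']
  simp

theorem norm_le_and_inner_le_of_mem_smul {n : ℕ} {u y : EuclideanSpace ℝ (Fin n)} {Q t : ℝ}
    (hQ : 0 < Q) (ht : 0 ≤ t) (hy : y ∈ t • convexBodyOf u Q) :
    ‖y‖ ≤ t * Q ∧ |inner ℝ y u| * Q ^ n ≤ t * Q := by
  obtain ⟨z, ⟨hz1, hz2⟩, rfl⟩ := hy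
  constructor
  · simp only [norm_smul, Real.norm_eq_abs, abs_of_nonneg ht]
    gcongr
  · simp only [real_inner_smul_left, abs_mul, abs_of_nonneg ht, mul_assoc]
    refine mul_le_mul_of_nonneg_left ?_ ht
    calc _ ≤ Q ^ (-((n : ℤ) - 1)) * Q ^ n := by gcongr
      _ = Q := zpow_neg_mul_pow hQ n

theorem mem_smul_convexBodyOf {n : ℕ} {u y : EuclideanSpace ℝ (Fin n)} {Q t : ℝ}
    (hQ : 0 < Q) (ht : 0 < t) (h1 : ‖y‖ ≤ t * Q) (h2 : |inner ℝ y u| * Q ^ n ≤ t * Q) :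
    y ∈ t • convexBodyOf u Q := by
  rw [Set.mem_smul_set_iff_inv_smul_mem₀ ht.ne']
  constructor
  · rw [norm_smul, norm_inv, Real.norm_eq_abs, abs_of_pos ht, inv_mul_le_iff₀ ht]
    exact h1
  · rw [real_inner_smul_left, abs_mul, abs_inv, abs_of_pos ht, inv_mul_le_iff₀ ht]
    refine le_of_mul_le_mul_right ?_ (pow_pos hQ n)
    rwa [mul_assoc, zpow_neg_mul_pow hQ]

theorem one_le_abs_det_of_int {n : ℕ} (y : Fin n → Fin n → ℤ)
    (h : (Matrix.of fun i c => (y i c : ℝ)).det ≠ 0) :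
    1 ≤ |(Matrix.of fun i c => (y i c : ℝ)).det| := by
  have hcast : (Matrix.of fun i c => (y i c : ℝ)).det = ((Matrix.of y).det : ℝ) := by
    have := (Int.castRingHom ℝ).map_det (Matrix.of y)
    simp only [eq_intCast] at this
    rw [this]
    rfl
  rw [hcast] at h ⊢
  exact_mod_cast Int.one_le_abs (by exact_mod_cast h)

/-- One of `j + 1` independent vectors can be exchanged with a row of index at least `j`. -/
theorem exists_updateRow_det_ne_zero {n : ℕ} (M : Matrix (Fin n) (Fin n) ℝ) (hM : M.det ≠ 0)
    (j : Fin n) (z : Fin (j + 1) → Fin n → ℝ) (hz : LinearIndependent ℝ z) :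
    ∃ i k, j ≤ k ∧ (M.updateRow k (z i)).det ≠ 0 := by
  have hunit : IsUnit M.det := isUnit_iff_ne_zero.2 hM
  have hcoef : ∀ i, ∑ k, Matrix.vecMul (z i) M⁻¹ k • M k = z i := by
    intro i
    have : Matrix.vecMul (Matrix.vecMul (z i) M⁻¹) M = z i := by
      rw [Matrix.vecMul_vecMul, Matrix.nonsing_inv_mul _ hunit, Matrix.vecMul_one]
    conv_rhs => rw [← this]
    ext c
    simp [Matrix.vecMul, dotProduct]
  by_contra hcon
  push Not at hcon
  -- If every exchange failed, all coordinates on rows of index at least j would vanish, putting j +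
  -- 1 independent vectors in the span of j rows.
  have hzero : ∀ i k, j ≤ k → Matrix.vecMul (z i) M⁻¹ k = 0 := by
    intro i k hk
    have h1 := hcon i k hk
    rw [← hcoef i, Matrix.det_updateRow_sum, smul_eq_mul] at h1
    exact (mul_eq_zero.1 h1).resolve_right hM
  have hmem : ∀ i, z i ∈ Submodule.span ℝ (Set.range fun l : Fin j => M ⟨l, l.2.trans j.2⟩) := by
    intro i
    rw [← hcoef i]
    refine Submodule.sum_mem _ fun k _ => ?_
    rcases le_or_gt j k with hk | hk
    · rw [hzero i k hk, zero_smul]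
      exact Submodule.zero_mem _
    · exact Submodule.smul_mem _ _ (Submodule.subset_span ⟨⟨k, hk⟩, rfl⟩)
  have h1 := Submodule.finrank_mono (Submodule.span_le.2 (Set.range_subset_iff.2 hmem))
  rw [finrank_span_eq_card hz, Fintype.card_fin] at h1
  have h2 := finrank_range_le_card (R := ℝ) (fun l : Fin j => M ⟨l, l.2.trans j.2⟩)
  rw [Fintype.card_fin] at h2
  rw [Set.finrank] at h2
  omega

/-- Bounds for the successive minima of `C_u(Q)` in terms of linearly independent points in
dilates of it. -/
theorem successiveMinimum_bounds {n : ℕ} {u : EuclideanSpace ℝ (Fin n)} (hu : ‖u‖ = 1) {Q : ℝ}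
    (hQ : 0 < Q) (y : Fin n → Fin n → ℤ) (hdet : (Matrix.of fun i c => (y i c : ℝ)).det ≠ 0)
    {b : Fin n → ℝ} (hb : ∀ i, 0 < b i) (hmono : Monotone b)
    (hnorm : ∀ i, ‖integerPoint (y i)‖ ≤ b i * Q)
    (hinner : ∀ i, |inner ℝ (integerPoint (y i)) u| * Q ^ n ≤ b i * Q) (j : Fin n) :
    successiveMinimum (convexBodyOf u Q) (j + 1) ≤ b j ∧
      b j ≤ 2 ^ n * (∏ i, b i) * successiveMinimum (convexBodyOf u Q) (j + 1) := by
  have htoLp : ∀ {ι : Type} (z : ι → Fin n → ℤ),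
      LinearIndependent ℝ (fun k => integerPoint (z k)) ↔
        LinearIndependent ℝ (fun k => fun c => (z k c : ℝ)) := by
    intro ι z
    exact LinearMap.linearIndependent_iff (v := fun k => fun c => (z k c : ℝ))
      (WithLp.linearEquiv 2 ℝ (Fin n → ℝ)).symm.toLinearMap (LinearEquiv.ker _)
  have hmem : b j ∈ {t : ℝ | 0 ≤ t ∧ ∃ z : Fin (j + 1) → Fin n → ℤ,
      LinearIndependent ℝ (fun k => integerPoint (z k)) ∧
        ∀ k, integerPoint (z k) ∈ t • convexBodyOf u Q} := by
    refine ⟨(hb j).le, fun k => y (Fin.castLE j.2 k), ?_, fun k => ?_⟩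
    · rw [htoLp]
      have h1 : LinearIndependent ℝ (Matrix.of fun i c => (y i c : ℝ)).row :=
        Matrix.linearIndependent_rows_iff_isUnit.2
          ((Matrix.isUnit_iff_isUnit_det _).2 (isUnit_iff_ne_zero.2 hdet))
      exact h1.comp _ (Fin.castLE_injective j.2)
    · have hle : b (Fin.castLE j.2 k) ≤ b j := hmono (Fin.le_def.2 (Nat.le_of_lt_succ k.2))
      refine mem_smul_convexBodyOf hQ (hb j) ((hnorm _).trans ?_) ((hinner _).trans ?_) <;> gcongr
  refine ⟨csInf_le ⟨0, fun t ht => ht.1⟩ hmem, ?_⟩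
  have hpos : 0 < 2 ^ n * ∏ i, b i := mul_pos (by positivity) (Finset.prod_pos fun i _ => hb i)
  rw [← div_le_iff₀' hpos]
  refine le_csInf ⟨_, hmem⟩ ?_
  rintro t ⟨ht, z, hz, hzmem⟩
  rw [div_le_iff₀' hpos]
  -- After the exchange, 1 ≤ |det| ≤ 2^n t ∏_{l≠k} b_l. Multiplying by b_k ≥ b_j restores the full
  -- product.
  obtain ⟨i, k, hjk, hik⟩ := exists_updateRow_det_ne_zero _ hdet j _ ((htoLp z).1 hz)
  have hupd : (Matrix.of fun i c => (y i c : ℝ)).updateRow k (fun c => (z i c : ℝ))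
      = Matrix.of fun l c => (Function.update y k (z i) l c : ℝ) := by
    ext l c
    by_cases hl : l = k
    · subst hl; simp
    · simp [hl]
  rw [hupd] at hik
  have h1 := one_le_abs_det_of_int _ hik
  obtain ⟨hz1, hz2⟩ := norm_le_and_inner_le_of_mem_smul hQ ht (hzmem i)
  have h2 := abs_det_le_of_mem_dilates
    (Matrix.of fun l c => (Function.update y k (z i) l c : ℝ)) u hu Q hQ
    (Function.update b k t)
    (fun l => by
      change ‖integerPoint (Function.update y k (z i) l)‖ ≤ _
      by_cases hl : l = k
      · subst hl; simpa using hz1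
      · simpa [hl] using hnorm l)
    (fun l => by
      change |inner ℝ (integerPoint (Function.update y k (z i) l)) u| * Q ^ n ≤ _
      by_cases hl : l = k
      · subst hl; simpa using hz2
      · simpa [hl] using hinner l)
  rw [Finset.prod_update_of_mem (Finset.mem_univ k)] at h2
  calc b j ≤ b k * 1 := by rw [mul_one]; exact hmono hjk
    _ ≤ b k * (2 ^ n * (t * ∏ i ∈ Finset.univ \ {k}, b i)) :=
        mul_le_mul_of_nonneg_left (h1.trans h2) (hb k).le
    _ = 2 ^ n * (b k * ∏ i ∈ Finset.univ \ {k}, b i) * t := by ring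
    _ = _ := by
        rw [← Finset.erase_eq, Finset.mul_prod_erase _ _ (Finset.mem_univ k)]

/-! ### Quasi-regular systems and the final comparison. -/

theorem IsRegularSystem.isQuasiRegularSystem {n : ℕ} {a : ℝ} {P : ℝ → Fin n → ℝ}
    (h : IsRegularSystem n a P) : IsQuasiRegularSystem n a P := by
  obtain ⟨X, ρ, hρ, hX0, hX, hP⟩ := h
  have hpow : ∀ i, X i = ρ ^ i * X 0 := by
    intro i
    induction i with
    | zero => simp
    | succ i ih => rw [hX, ih, pow_succ]; ring
  have hpos : ∀ i, 0 < X i := fun i => by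
    rw [hpow]
    exact mul_pos (pow_pos (by linarith) i) hX0
  refine ⟨X, ⟨hpos, strictMono_nat_of_lt_succ fun i => ?_, ?_⟩, hP⟩
  · rw [hX]
    exact lt_mul_of_one_lt_left (hpos i) hρ
  · have h1 : Filter.Tendsto X Filter.atTop Filter.atTop := by
      rw [funext hpow]
      exact (tendsto_pow_atTop_atTop_of_one_lt hρ).atTop_mul_const hX0
    exact Filter.not_bddAbove_of_tendsto_atTop h1

theorem le_switchPoint {n : ℕ} (hn : 0 < n) {X : ℕ → ℝ} (hX : Monotone X) (i : ℕ) :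
    X i ≤ switchPoint n X i := by
  have hn' : (0 : ℝ) < n := by exact_mod_cast hn
  rw [switchPoint, le_div_iff₀ hn']
  calc X i * n = ∑ j ∈ Finset.range n, X i := by simp [mul_comm]
    _ ≤ _ := Finset.sum_le_sum fun j _ => hX (Nat.le_add_right i j)

theorem switchPoint_monotone (n : ℕ) {X : ℕ → ℝ} (hX : Monotone X) :
    Monotone (switchPoint n X) := by
  intro i k hik
  unfold switchPoint
  gcongr with j
  exact hX (by omega)

theorem exists_mem_Icc_switchPoint {n : ℕ} (hn : 0 < n) {X : ℕ → ℝ} (hX : IsAdmissible X) {q : ℝ}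
    (hq : switchPoint n X 0 ≤ q) :
    ∃ i, q ∈ Set.Icc (switchPoint n X i) (switchPoint n X (i + 1)) := by
  classical
  have hex : ∃ i, q < switchPoint n X i := by
    by_contra h
    push Not at h
    refine hX.unbounded ⟨q, ?_⟩
    rintro _ ⟨i, rfl⟩
    exact (le_switchPoint hn hX.strictMono.monotone i).trans (h i)
  have hspec := Nat.find_spec hex
  have hne : Nat.find hex ≠ 0 := fun h => by
    rw [h] at hspec
    exact absurd hq (not_le.2 hspec)
  obtain ⟨i, hi⟩ := Nat.exists_eq_succ_of_ne_zero hne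
  refine ⟨i, not_lt.1 (Nat.find_min hex (by omega)), ?_⟩
  rw [hi] at hspec
  exact hspec.le

theorem mul_switchPoint (m : ℕ) (X : ℕ → ℝ) (i : ℕ) :
    ((m + 1 : ℕ) : ℝ) * switchPoint (m + 1) X i = X i + ∑ j : Fin m, X (i + j + 1) := by
  rw [switchPoint, mul_div_cancel₀ _ (by positivity), Finset.sum_range_succ', add_comm,
    ← Fin.sum_univ_eq_sum_range (fun j => X (i + (j + 1)))]
  rfl

/-- Because the sum vanishes, the product of the dilation factors is e^{nc}, independent of q. -/
theorem sum_unsortedSystem (m : ℕ) (X : ℕ → ℝ) (i : ℕ) (q : ℝ) :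
    ∑ j, unsortedSystem (m + 1) X i q j = 0 := by
  have h := mul_switchPoint m X i
  rw [Fin.sum_univ_succ]
  simp only [unsortedSystem, Fin.val_zero, if_true, Fin.val_succ, Nat.succ_ne_zero, if_false,
    Finset.sum_sub_distrib, Finset.sum_const, Finset.card_univ, Fintype.card_fin, nsmul_eq_mul,
    mul_sub, h, ← add_assoc]
  push_cast
  ring

/-- The proof uses 21 ≤ 8 · 2.7 and 8n ≤ 7^n ≤ e^{2n}. The bound is tuned to the final constant 2n².
-/
theorem log_mul_le {n : ℕ} (hn : 2 ≤ n) : Real.log (21 * n) ≤ 2 * n + 1 := by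
  have hnat : 8 * n ≤ 7 ^ n := by
    induction n, hn using Nat.le_induction with
    | base => norm_num
    | succ k hk ih => rw [pow_succ]; omega
  have hreal : (8 : ℝ) * n ≤ 7 ^ n := by exact_mod_cast hnat
  have hnpos : (0 : ℝ) < n := by
    have : 0 < n := by omega
    exact_mod_cast this
  rw [Real.log_le_iff_le_exp (by positivity)]
  have he := Real.exp_one_gt_d9
  have h7 : (7 : ℝ) ≤ Real.exp 2 := by
    rw [show (2 : ℝ) = 1 + 1 by norm_num, Real.exp_add]
    nlinarith
  have h1 : (7 : ℝ) ^ n ≤ Real.exp (2 * n) := by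
    rw [mul_comm, Real.exp_nat_mul]
    gcongr
  rw [Real.exp_add]
  calc 21 * (n : ℝ) ≤ (8 * n) * 2.7 := by linarith
    _ ≤ Real.exp (2 * n) * Real.exp 1 :=
        mul_le_mul (hreal.trans h1) (by linarith) (by norm_num) (Real.exp_pos _).le

/-- The points attached to a window lie in the dilates of the convex body given by the system. -/
theorem exp_bounds_of_points {m : ℕ} {X : ℕ → ℝ} (hX : Monotone X)
    {x : ℕ → Fin (m + 1) → ℤ} {u : EuclideanSpace ℝ (Fin (m + 1))} {c : ℝ} (hc : 0 ≤ c)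
    (hnorm : ∀ k, ‖integerPoint (x k)‖ ≤ Real.exp c * Real.exp (X k))
    (hinner : ∀ k, |inner ℝ (integerPoint (x k)) u| * ∏ j : Fin m, Real.exp (X (k + j + 1)) ≤ 1)
    {i : ℕ} {q : ℝ} (hq : q ∈ Set.Icc (switchPoint (m + 1) X i) (switchPoint (m + 1) X (i + 1)))
    (j : Fin (m + 1)) :
    ‖integerPoint (x (i + j))‖
        ≤ Real.exp (c + unsortedSystem (m + 1) X i q j) * Real.exp q ∧
      |inner ℝ (integerPoint (x (i + j))) u| * Real.exp q ^ (m + 1)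
        ≤ Real.exp (c + unsortedSystem (m + 1) X i q j) * Real.exp q := by
  -- These are the norm and inner product conditions in logarithmic form. For j = 0 the second is an
  -- equality and the first uses q ≥ q_i; for j > 0 the first is an equality and the second uses q ≤
  -- q_{i+1} ≤ q_{i+j}.
  have hsize : X (i + j) ≤ unsortedSystem (m + 1) X i q j + q ∧
      (m + 1 : ℕ) * q + X (i + j) - (m + 1 : ℕ) * switchPoint (m + 1) X (i + j)
        ≤ unsortedSystem (m + 1) X i q j + q := by
    have hm : (0 : ℝ) ≤ (m + 1 : ℕ) := by positivity
    unfold unsortedSystem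
    split_ifs with hj
    · rw [hj, add_zero]
      have := mul_nonneg hm (sub_nonneg.2 hq.1)
      constructor <;> linarith
    · have h1 : q ≤ switchPoint (m + 1) X (i + j) :=
        hq.2.trans (switchPoint_monotone (m + 1) hX (by omega))
      have := mul_nonneg hm (sub_nonneg.2 h1)
      constructor <;> linarith
  constructor
  · refine (hnorm _).trans ?_
    rw [← Real.exp_add, ← Real.exp_add, Real.exp_le_exp]
    linarith [hsize.1]
  · have h1 := hinner (i + j)
    rw [← Real.exp_sum] at h1
    have h2 := mul_switchPoint m X (i + j)
    have h3 : |inner ℝ (integerPoint (x (i + j))) u|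
        ≤ Real.exp (-∑ l : Fin m, X (i + j + l + 1)) := by
      rw [Real.exp_neg, ← one_div, le_div_iff₀ (Real.exp_pos _)]
      exact h1
    calc _ ≤ Real.exp (-∑ l : Fin m, X (i + j + l + 1)) * Real.exp q ^ (m + 1) := by gcongr
      _ ≤ _ := by
          rw [← Real.exp_nat_mul, ← Real.exp_add, ← Real.exp_add, Real.exp_le_exp]
          linarith [hsize.2]

theorem exists_unit_vector_of_mesh {m : ℕ} (hm : 1 ≤ m) {q₁ : ℝ} {P : ℝ → Fin (m + 1) → ℝ}
    (hP : IsQuasiRegularSystemWithMesh (m + 1) (Real.log 4) q₁ P) :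
    ∃ u : EuclideanSpace ℝ (Fin (m + 1)), ‖u‖ = 1 ∧
      ∀ q : ℝ, q₁ ≤ q → ‖P q - logMinima u q‖ ≤ 2 * ((m + 1 : ℕ) : ℝ) ^ 2 := by
  obtain ⟨X, hX, hgen, hmesh⟩ := hP
  obtain ⟨x, u, hu, hdet, hnorm, hinner⟩ := exists_points_and_unit_vector hm
    (A := fun k => Real.exp (X k)) (fun k => Real.one_le_exp (hX.pos k).le) (fun k => by
      calc 4 * Real.exp (X k) = Real.exp (X k + Real.log 4) := by
            rw [Real.exp_add, Real.exp_log (by norm_num)]; ring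
        _ ≤ _ := Real.exp_le_exp.2 (hmesh k))
  refine ⟨u, hu, fun q hq => ?_⟩
  have hmono := hX.strictMono.monotone
  rw [hgen.start] at hq
  obtain ⟨i, hi⟩ := exists_mem_Icc_switchPoint (Nat.succ_pos m) hX hq
  have hn2 : 2 ≤ m + 1 := by omega
  set N : ℝ := ((m + 1 : ℕ) : ℝ) with hN
  have hN2 : 2 ≤ N := by rw [hN]; exact_mod_cast hn2
  set c := Real.log (21 * N) with hc
  have hc0 : 0 ≤ c := Real.log_nonneg (by linarith)
  have hcle : c ≤ 2 * N + 1 := log_mul_le hn2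
  have hexpc : Real.exp c = 21 * (m + 1) := by
    rw [hc, Real.exp_log (by linarith), hN]
    push_cast
    ring
  set p := unsortedSystem (m + 1) X i q with hp
  set σ := Tuple.sort p with hσ
  have hPq : P q = p ∘ σ := hgen.eq_sort i q hi
  have hPmono : Monotone (p ∘ σ) := Tuple.monotone_sort p
  have hsum : ∑ j, (p ∘ σ) j = 0 := by
    rw [← sum_unsortedSystem m X i q]
    exact Equiv.sum_comp σ p
  have hpts := exp_bounds_of_points hmono hc0 (fun k => by rw [hexpc]; exact hnorm k) hinner hi
  have hdetσ : (Matrix.of fun (j l : Fin (m + 1)) => (x (i + σ j) l : ℝ)).det ≠ 0 := by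
    have h1 := Matrix.det_permute σ (Matrix.of fun j l : Fin (m + 1) => (x (i + j) l : ℝ))
    have h2 : (Matrix.of fun j l : Fin (m + 1) => (x (i + j) l : ℝ)).submatrix σ id
        = Matrix.of fun (j l : Fin (m + 1)) => (x (i + σ j) l : ℝ) := rfl
    rw [← h2, h1]
    refine mul_ne_zero ?_ (hdet i)
    rcases Int.units_eq_one_or (Equiv.Perm.sign σ) with hs | hs <;> simp [hs]
  have hbounds := successiveMinimum_bounds hu (Real.exp_pos q) (fun j => x (i + σ j)) hdetσ
    (b := fun j => Real.exp (c + (p ∘ σ) j)) (fun _ => Real.exp_pos _)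
    (fun j k hjk => Real.exp_le_exp.2 (add_le_add_right (hPmono hjk) c))
    (fun j => (hpts (σ j)).1) (fun j => (hpts (σ j)).2)
  have hprod : ∏ j, Real.exp (c + (p ∘ σ) j) = Real.exp (N * c) := by
    rw [← Real.exp_sum, Finset.sum_add_distrib, hsum]
    simp [hN]
  rw [pi_norm_le_iff_of_nonneg (by positivity)]
  intro j
  obtain ⟨hle, hge⟩ := hbounds j
  rw [hprod] at hge
  simp only [Pi.sub_apply, hPq, logMinima]
  set L := successiveMinimum (convexBodyOf u (Real.exp q)) (j + 1) with hL
  have hLpos : 0 < L := by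
    have h1 : 0 < 2 ^ (m + 1) * Real.exp (N * c) := by positivity
    exact pos_of_mul_pos_right ((Real.exp_pos _).trans_le hge) h1.le
  have hlog1 : Real.log L ≤ c + (p ∘ σ) j := (Real.log_le_iff_le_exp hLpos).2 hle
  have hlog2 : c + (p ∘ σ) j ≤ N * Real.log 2 + N * c + Real.log L := by
    have h1 := Real.log_le_log (Real.exp_pos _) hge
    rw [Real.log_exp, Real.log_mul (by positivity) hLpos.ne',
      Real.log_mul (by positivity) (Real.exp_pos _).ne', Real.log_exp, Real.log_pow] at h1
    exact h1
  have hlogtwo : Real.log 2 ≤ 1 := by linarith [Real.log_two_lt_d9]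
  rw [Real.norm_eq_abs, abs_le]
  constructor
  · nlinarith
  -- The error is at most N log 2 + (N - 1)c ≤ N + (N - 1)(2N + 1) = 2N² - 1.
  · have h1 : N * Real.log 2 ≤ N := mul_le_of_le_one_right (by linarith) hlogtwo
    have h2 : (N - 1) * c ≤ (N - 1) * (2 * N + 1) :=
      mul_le_mul_of_nonneg_left hcle (by linarith)
    nlinarith

theorem theorem1 (n : ℕ) (hn : 2 ≤ n) :
    (∀ (a : ℝ) (P : ℝ → Fin n → ℝ), IsRegularSystem n a P → IsQuasiRegularSystem n a P) ∧
    (∀ (q₁ : ℝ) (P : ℝ → Fin n → ℝ), IsQuasiRegularSystemWithMesh n (Real.log 4) q₁ P →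
      ∃ u : EuclideanSpace ℝ (Fin n), ‖u‖ = 1 ∧
        ∀ q : ℝ, q₁ ≤ q → ‖P q - logMinima u q‖ ≤ 2 * (n : ℝ) ^ 2) := by
  refine ⟨fun a P h => h.isQuasiRegularSystem, fun q₁ P hP => ?_⟩
  obtain ⟨m, rfl⟩ := Nat.exists_eq_succ_of_ne_zero (show n ≠ 0 by omega)
  exact exists_unit_vector_of_mesh (by omega) hP
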